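/- Let $M$ be a smooth $m$-dimensional manifold without boundary (Hausdorff and second countable, not necessarily compact), and let $\phi:\mathbb R\times M\to M$ be a smooth flow, i.e. $\phi$ is smooth, $\phi(0,x)=x$ and $\phi(t,\phi(s,x))=\phi(t+s,x)$ for all $s,t\in\mathbb R$, $x\in M$. For $N\subset M$ put $\mathrm{Inv}(N,\phi)=\{x\in N:\phi(t,x)\in N\ \forall t\in\mathbb R\}$. A compact set $N\subset M$ is an isolating neighborhood if $\mathrm{Inv}(N,\phi)\subset\mathrm{int}(N)$; it is an isolating neighborhood for $S$ if moreover $\mathrm{Inv}(N,\phi)=S$. A set $S\subset M$ is an isolated invariant set if $\phi(t,S)=S$ for all $t\in\mathbb R$ and $S$ has an isolating neighborhood. An isolating neighborhood $B\subset M$ is a smooth isolating block if $B$ is a compact $m$-dimensional submanifold of $M$ with piecewise smooth boundary $\partial B$ (locally a topological half-space at boundary points, with $\partial B$ covered by finitely many smooth hypersurfaces) such that (i) $\partial B=B_+\cup B_-\cup B_\pm$ with $B_+\cap B_-=B_\pm$, and $B_-\setminus B_\pm$, $B_+\setminus B_\pm$ are (possibly empty) smooth $(m-1)$-dimensional submanifolds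 of $M$; (ii) there are smooth $(m-1)$-dimensional submanifolds without boundary $D_-,D_+$ of $M$ with $B_+\subset D_+$, $B_-\subset D_-$, such that $D_-\cap D_+=B_\pm$ is a (possibly empty) $(m-2)$-dimensional smooth submanifold; (iii) the flow is transverse to $D_-$ and $D_+$, and for every $x\in D_-$ (respectively $x\in D_+$) there is $\epsilon>0$ such that $\phi(t,x)\notin B$ for all $t\in(0,\epsilon)$ (respectively all $t\in(-\epsilon,0)$). A smooth function $f:M\to\mathbb R$ has the Lyapunov property for $S$ with respect to a set $N$ if $\frac{d}{dt}\big|_{t=0}f(\phi(t,x))<0$ for all $x\in N\setminus S$. It is a smooth Lyapunov function for $S$ if it is constant on $S$ and has the Lyapunov property with respect to some isolating neighborhood $N$ for $S$. Proposition. Let $S\subset M$ be an isolated invariant set for $\phi$ and let $B\subset M$ be a smooth isolating block with $\mathrm{Inv}(B,\phi)=S$. Then there exists a smooth Lyapunov function $f_\phi:M\to\mathbb R$ for $S$ which has the Lyapunov property with respect to $B$; that is, $f_\phi$ is smooth and constant on $S$, and $\frac{d}{dt}\big|_{t=0}f_\phi(\phi(t,x))<0$ for all $x\in B\setminus S$.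 -/

import Mathlib

open scoped Manifold ContDiff
open Set

namespace IsolatedDynamics

section Flows

variable {M : Type*} [TopologicalSpace M]

/-- The maximal invariant set of the flow `φ` in `N`. -/
def maxInv (φ : Flow ℝ M) (N : Set M) : Set M :=
  {x | x ∈ N ∧ ∀ t : ℝ, φ t x ∈ N}

/-- An isolating neighborhood: a compact set whose maximal invariant set lies in its interior. -/
def IsIsolatingNeighborhood (φ : Flow ℝ M) (N : Set M) : Prop :=
  IsCompact N ∧ maxInv φ N ⊆ interior N

/-- An isolated invariant set: `φ(t, S) = S` for all `t`, and `S` is the maximal invariant set of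
some isolating neighborhood. -/
def IsIsolatedInvariantSet (φ : Flow ℝ M) (S : Set M) : Prop :=
  (∀ t : ℝ, φ t '' S = S) ∧ ∃ N : Set M, IsIsolatingNeighborhood φ N ∧ S = maxInv φ N

/-- The Lyapunov property of `f` for `S` with respect to `N`: the derivative of `f` along the flow
is negative on `N \ S`. -/
def HasLyapunovProperty (φ : Flow ℝ M) (S N : Set M) (f : M → ℝ) : Prop :=
  ∀ x ∈ N \ S, deriv (fun t : ℝ => f (φ t x)) 0 < 0

end Flows

section Manifolds

variable {m : ℕ} {M : Type*} [TopologicalSpace M] [ChartedSpace (EuclideanSpace ℝ (Fin m)) M]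

/-- `h` is a local defining map of `D` near `p`, on the open set `U`: it is a smooth submersion
from `U` to `ℝ^c` and `D ∩ U` is its zero set in `U`. -/
structure IsLocalDefiningMap (c : ℕ) (D : Set M) (p : M) (U : Set M)
    (h : M → EuclideanSpace ℝ (Fin c)) : Prop where
  isOpen : IsOpen U
  mem : p ∈ U
  smooth : ContMDiffOn (𝓡 m) (𝓡 c) ∞ h U
  submersion : ∀ x ∈ U, Function.Surjective (mfderiv (𝓡 m) (𝓡 c) h x)
  eq_zero_iff : ∀ x ∈ U, x ∈ D ↔ h x = 0

/-- `D` is a smooth embedded submanifold of `M` (without boundary, not necessarily closed in `M`)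
of codimension `c`, that is, of dimension `m - c`. The empty set is allowed, and is the only
such set if `m < c`. -/
def IsSmoothSubmanifold (c : ℕ) (D : Set M) : Prop :=
  ∀ p ∈ D, ∃ U h, IsLocalDefiningMap (m := m) c D p U h

/-- The flow is transverse to the smooth hypersurface `D`: at each `p ∈ D` the generating vector
`X p` is not in `T_p D = ker dh_p`, where `h` is a local defining map of `D`. Here
`dh_p (X p)` is the derivative of `h` along the flow. -/
def IsTransverseTo (φ : Flow ℝ M) (D : Set M) : Prop :=
  ∀ p ∈ D, ∀ U h, IsLocalDefiningMap (m := m) 1 D p U h → deriv (fun t : ℝ => h (φ t p)) 0 ≠ 0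

/-- `B` is a compact submanifold of `M` of full dimension with piecewise smooth boundary: near a
boundary point there is a topological chart of `M` in which `B` is a half-space, and
the boundary is contained in a finite union of smooth hypersurfaces. -/
def IsCompactDomainWithPiecewiseSmoothBoundary (B : Set M) : Prop :=
  IsCompact B ∧
  (∀ p ∈ frontier B, ∃ (e : OpenPartialHomeomorph M (EuclideanSpace ℝ (Fin m))) (i : Fin m),
    p ∈ e.source ∧ e p i = 0 ∧ ∀ x ∈ e.source, x ∈ B ↔ 0 ≤ e x i) ∧
  ∃ (n : ℕ) (H : Fin n → Set M),
    (∀ j, IsSmoothSubmanifold (m := m) 1 (H j)) ∧ frontier B ⊆ ⋃ j, H j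

/-- A smooth isolating block. The sets `Bp`, `Bm`, `Bc` are `B₊`, `B₋`, `B_±` (entrance part,
exit part and corners of the boundary), and `Dp`, `Dm` are the hypersurfaces `D₊`, `D₋`. -/
def IsSmoothIsolatingBlock (φ : Flow ℝ M) (B : Set M) : Prop :=
  IsIsolatingNeighborhood φ B ∧
  IsCompactDomainWithPiecewiseSmoothBoundary (m := m) B ∧
  ∃ Bp Bm Bc Dp Dm : Set M,
    (frontier B = Bp ∪ Bm ∪ Bc ∧ Bp ∩ Bm = Bc ∧
      IsSmoothSubmanifold (m := m) 1 (Bm \ Bc) ∧ IsSmoothSubmanifold (m := m) 1 (Bp \ Bc)) ∧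
    (IsSmoothSubmanifold (m := m) 1 Dm ∧ IsSmoothSubmanifold (m := m) 1 Dp ∧
      Bp ⊆ Dp ∧ Bm ⊆ Dm ∧ Dm ∩ Dp = Bc ∧ IsSmoothSubmanifold (m := m) 2 Bc) ∧
    (IsTransverseTo (m := m) φ Dm ∧ IsTransverseTo (m := m) φ Dp ∧
      (∀ x ∈ Dm, ∃ ε > (0 : ℝ), ∀ t ∈ Ioo 0 ε, φ t x ∉ B) ∧
      (∀ x ∈ Dp, ∃ ε > (0 : ℝ), ∀ t ∈ Ioo (-ε) 0, φ t x ∉ B))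

/-- A smooth Lyapunov function for `(S, φ)`: a smooth function on `M` which is constant on `S` and
has the Lyapunov property with respect to some isolating neighborhood of `S`. -/
def IsSmoothLyapunovFunction (φ : Flow ℝ M) (S : Set M) (f : M → ℝ) : Prop :=
  ContMDiff (𝓡 m) 𝓘(ℝ, ℝ) ∞ f ∧
  (∃ a : ℝ, ∀ x ∈ S, f x = a) ∧
  ∃ N : Set M, IsIsolatingNeighborhood φ N ∧ maxInv φ N = S ∧ HasLyapunovProperty φ S N f

end Manifolds

end IsolatedDynamics

/-! A point `x` of `B \ S` lies outside `B` at some time `-T`. Take a bump `h` at `x` supported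
where the time `-T` map leaves `B`, and average it: `g y = ∫ s in 0..T, h (φ s y)`. Along the flow
`g` has derivative `h (φ T y) - h y`. For `y ∈ B` the first term vanishes, since flowing `φ T y`
back by `T` lands in `B`; so the derivative is `-h y ≤ 0`, and it is negative near `x`. Orbits in
`S` never meet the support, so `g = 0` on `S`. By the Lindelöf property countably many sets `{h >
0}` cover `B \ S`. A weighted sum of the corresponding `g` is the Lyapunov function;
`exists_contMDiff_tsum` supplies weights that keep it smooth. -/

theorem contDiffOn_setIntegral_Ioc {P : Type*} [NormedAddCommGroup P] [NormedSpace ℝ P]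
    {s : Set P} (hs : IsOpen s) {F : P × ℝ → ℝ} (hF : ContDiffOn ℝ ∞ F (s ×ˢ univ)) (a b : ℝ) :
    ContDiffOn ℝ ∞ (fun p => ∫ t in Ioc a b, F (p, t)) s := by
  -- The integral is the convolution at `0` of the indicator of `Ioc a b` with `g p`, hence the
  -- reflection `-t`. The cutoff supplies compact support in `t` and equals `1` on `-Ioc a b`.
  let χ : ContDiffBump (0 : ℝ) := ⟨|a| + |b| + 1, |a| + |b| + 2, by positivity, by linarith⟩
  let g : P → ℝ → ℝ := fun p t => χ t * F (p, -t)
  have hg : ContDiffOn ℝ ∞ (Function.uncurry g) (s ×ˢ univ) := by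
    refine ContDiffOn.mul (χ.contDiff.comp contDiff_snd).contDiffOn ?_
    refine hF.comp (contDiff_fst.prodMk contDiff_snd.neg).contDiffOn ?_
    rintro ⟨p, t⟩ h
    exact ⟨h.1, mem_univ _⟩
  have hf : MeasureTheory.LocallyIntegrable ((Ioc a b).indicator fun _ => (1 : ℝ))
      MeasureTheory.volume :=
    (MeasureTheory.locallyIntegrable_const (1 : ℝ)).indicator measurableSet_Ioc
  have key := MeasureTheory.contDiffOn_convolution_right_with_param_comp (n := ⊤)
    (ContinuousLinearMap.mul ℝ ℝ) (v := fun _ : P => (0 : ℝ)) contDiffOn_const hs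
    (isCompact_closedBall (0 : ℝ) (|a| + |b| + 2)) (g := g) (fun p t _ ht => by
      have : χ t = 0 := by
        rw [← Function.notMem_support, χ.support_eq]
        exact fun h => ht (Metric.ball_subset_closedBall h)
      simp [g, this]) hf hg
  refine key.congr fun p _ => ?_
  rw [MeasureTheory.convolution_def, ← MeasureTheory.integral_indicator measurableSet_Ioc]
  congr 1
  ext t
  by_cases ht : t ∈ Ioc a b
  · have hχ : χ (-t) = 1 := by
      refine χ.one_of_mem_closedBall ?_
      rw [mem_closedBall_zero_iff, norm_neg, Real.norm_eq_abs, abs_le]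
      have := neg_abs_le a
      have := le_abs_self b
      have := abs_nonneg a
      have := abs_nonneg b
      constructor <;> simp only [χ] <;> linarith [ht.1, ht.2]
    simp only [indicator_of_mem ht, g, ContinuousLinearMap.mul_apply', zero_sub, neg_neg, hχ,
      one_mul]
  · simp [ht]

/-- Interval integrals of a smooth function depend smoothly on a parameter. -/
theorem contDiffOn_intervalIntegral {P : Type*} [NormedAddCommGroup P] [NormedSpace ℝ P]
    {s : Set P} (hs : IsOpen s) {F : P × ℝ → ℝ} (hF : ContDiffOn ℝ ∞ F (s ×ˢ univ)) (a b : ℝ) :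
    ContDiffOn ℝ ∞ (fun p => ∫ t in a..b, F (p, t)) s :=
  (contDiffOn_setIntegral_Ioc hs hF a b).sub (contDiffOn_setIntegral_Ioc hs hF b a)

section
variable {m : ℕ} {M : Type*} [TopologicalSpace M] [ChartedSpace (EuclideanSpace ℝ (Fin m)) M]

theorem contMDiffAt_of_eventuallyEq_comp_extChartAt {f : M → ℝ} {x : M}
    {F : EuclideanSpace ℝ (Fin m) → ℝ} (hF : ContDiffAt ℝ ∞ F (extChartAt (𝓡 m) x x))
    (hf : f =ᶠ[nhds x] F ∘ extChartAt (𝓡 m) x) : ContMDiffAt (𝓡 m) 𝓘(ℝ, ℝ) ∞ f x :=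
  (hF.contMDiffAt.comp x contMDiffAt_extChartAt).congr_of_eventuallyEq hf

variable [IsManifold (𝓡 m) ∞ M]

/-- The time average of a smooth function along a smooth flow is smooth. -/
theorem contMDiff_flow_intervalIntegral {φ : Flow ℝ M}
    (hφ : ContMDiff (𝓘(ℝ, ℝ).prod (𝓡 m)) (𝓡 m) ∞ (fun q : ℝ × M => φ q.1 q.2))
    {h : M → ℝ} (hh : ContMDiff (𝓡 m) 𝓘(ℝ, ℝ) ∞ h) (a b : ℝ) :
    ContMDiff (𝓡 m) 𝓘(ℝ, ℝ) ∞ fun x => ∫ s in a..b, h (φ s x) := by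
  intro x
  set e := extChartAt (𝓡 m) x
  have hopen : IsOpen e.target := isOpen_extChartAt_target x
  have hF : ContDiffOn ℝ ∞ (fun q : EuclideanSpace ℝ (Fin m) × ℝ => h (φ q.2 (e.symm q.1)))
      (e.target ×ˢ univ) := by
    rw [← contMDiffOn_iff_contDiffOn, modelWithCornersSelf_prod, ← chartedSpaceSelf_prod]
    refine (hh.comp hφ).comp_contMDiffOn (contMDiff_snd.contMDiffOn.prodMk ?_)
    exact (contMDiffOn_extChartAt_symm x).comp contMDiff_fst.contMDiffOn fun q hq => hq.1
  refine contMDiffAt_of_eventuallyEq_comp_extChartAt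
    ((contDiffOn_intervalIntegral hopen hF a b).contDiffAt
      (hopen.mem_nhds (mem_extChartAt_target x))) ?_
  filter_upwards [extChartAt_source_mem_nhds (I := 𝓡 m) x] with y hy
  simp only [e, Function.comp_apply, (extChartAt (𝓡 m) x).left_inv hy]

theorem hasDerivAt_flow_intervalIntegral (φ : Flow ℝ M) {h : M → ℝ} (hh : Continuous h)
    (T : ℝ) (x : M) (t : ℝ) :
    HasDerivAt (fun t => ∫ s in (0)..T, h (φ s (φ t x))) (h (φ T (φ t x)) - h (φ t x)) t := by
  have hc : Continuous fun s => h (φ s x) := by fun_prop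
  -- Moving the base point along its orbit translates the interval of integration, so only the
  -- endpoints contribute.
  have key : (fun t => ∫ s in (0)..T, h (φ s (φ t x))) =
      fun t => (∫ s in (0)..(T + t), h (φ s x)) - ∫ s in (0)..t, h (φ s x) := by
    ext t
    simp_rw [← φ.map_add]
    rw [intervalIntegral.integral_comp_add_right (fun s => h (φ s x)),
      intervalIntegral.integral_interval_sub_left (hc.intervalIntegrable _ _)
        (hc.intervalIntegrable _ _), zero_add]
  rw [key, ← φ.map_add]
  exact ((hc.integral_hasStrictDerivAt 0 (T + t)).hasDerivAt.comp_const_add T t).sub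
    (hc.integral_hasStrictDerivAt 0 t).hasDerivAt

/-- Any sequence of smooth functions on a second countable manifold has a smooth sum
after multiplication with suitable positive constants. -/
theorem exists_contMDiff_tsum [SecondCountableTopology M] {g : ℕ → M → ℝ}
    (hg : ∀ k, ContMDiff (𝓡 m) 𝓘(ℝ, ℝ) ∞ (g k)) :
    ∃ ε : ℕ → ℝ, (∀ k, 0 < ε k) ∧ Summable ε ∧ (∀ x, Summable fun k => ε k * g k x) ∧
      ContMDiff (𝓡 m) 𝓘(ℝ, ℝ) ∞ fun x => ∑' k, ε k * g k x := by
  rcases isEmpty_or_nonempty M with hM | hM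
  · exact ⟨fun k => (1 / 2) ^ k, fun k => by positivity, summable_geometric_two,
      fun x => isEmptyElim x, fun x => isEmptyElim x⟩
  have hball (x : M) : ∃ χ : ContDiffBump (extChartAt (𝓡 m) x x),
      Metric.closedBall (extChartAt (𝓡 m) x x) χ.rOut ⊆ (extChartAt (𝓡 m) x).target := by
    obtain ⟨r, hr, h⟩ := Metric.nhds_basis_closedBall.mem_iff.1
      (extChartAt_target_mem_nhds (I := 𝓡 m) x)
    exact ⟨⟨r / 2, r, half_pos hr, half_lt_self hr⟩, h⟩
  choose χ hχ using hball
  let G : M → ℕ → EuclideanSpace ℝ (Fin m) → ℝ := fun x k y =>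
    χ x y * g k ((extChartAt (𝓡 m) x).symm y)
  have hG x k : ContDiff ℝ ∞ (G x k) := by
    rw [contDiff_iff_contDiffAt]
    intro y
    by_cases hy : y ∈ (extChartAt (𝓡 m) x).target
    · refine (χ x).contDiffAt.mul ?_
      have := (hg k).comp_contMDiffOn (contMDiffOn_extChartAt_symm (I := 𝓡 m) (n := ∞) x)
      exact (contMDiffOn_iff_contDiffOn.1 this).contDiffAt
        ((isOpen_extChartAt_target x).mem_nhds hy)
    · have hy' : y ∉ tsupport (χ x) := fun h => hy (hχ x ((χ x).tsupport_eq ▸ h))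
      refine contDiffAt_const (c := (0 : ℝ)) |>.congr_of_eventuallyEq ?_
      filter_upwards [notMem_tsupport_iff_eventuallyEq.1 hy'] with z hz
      simp only [G, hz, Pi.zero_apply, zero_mul]
  have hGs x k : HasCompactSupport (G x k) := (χ x).hasCompactSupport.mul_right
  have hbound x k n : ∃ C, ∀ y, ‖iteratedFDeriv ℝ n (G x k) y‖ ≤ C :=
    ((hGs x k).iteratedFDeriv n).exists_bound_of_continuous
      ((hG x k).continuous_iteratedFDeriv (by exact_mod_cast le_top))
  choose C hC using hbound
  have hnhds (x : M) : extChartAt (𝓡 m) x ⁻¹' (Metric.ball (extChartAt (𝓡 m) x x) (χ x).rIn) ∩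
      (extChartAt (𝓡 m) x).source ∈ nhds x :=
    Filter.inter_mem ((continuousAt_extChartAt x).preimage_mem_nhds
      (Metric.ball_mem_nhds _ (χ x).rIn_pos)) (extChartAt_source_mem_nhds x)
  obtain ⟨c, hc, hcover⟩ := TopologicalSpace.countable_cover_nhds hnhds
  obtain ⟨p, rfl⟩ := hc.exists_eq_range (by
    by_contra h
    rw [not_nonempty_iff_eq_empty.1 h] at hcover
    simp only [mem_empty_iff_false, iUnion_of_empty, iUnion_empty] at hcover
    exact empty_ne_univ hcover)
  -- Diagonal choice: `A k` bounds the derivatives of order at most `k` in the first `k + 1` charts,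
  -- so for fixed `i` and `n` the bound holds for all large `k`. The summand `1` gives `ε k ≤ (1 /
  -- 2) ^ k`.
  let A : ℕ → ℝ := fun k =>
    1 + ∑ i ∈ Finset.range (k + 1), ∑ n ∈ Finset.range (k + 1), |C (p i) k n|
  have hA k : 0 < A k := by positivity
  have hCA i k n (hi : i ≤ k) (hn : n ≤ k) : C (p i) k n ≤ A k := by
    have h1 : |C (p i) k n| ≤ ∑ n ∈ Finset.range (k + 1), |C (p i) k n| :=
      Finset.single_le_sum (f := fun n => |C (p i) k n|) (fun _ _ => abs_nonneg _)
        (Finset.mem_range.2 (Nat.lt_succ_of_le hn))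
    have h2 := Finset.single_le_sum
      (f := fun i => ∑ n ∈ Finset.range (k + 1), |C (p i) k n|)
      (fun _ _ => Finset.sum_nonneg fun _ _ => abs_nonneg _)
      (Finset.mem_range.2 (Nat.lt_succ_of_le hi))
    have h3 := le_abs_self (C (p i) k n)
    simp only [A]
    linarith
  let ε : ℕ → ℝ := fun k => (1 / 2) ^ k / A k
  have hε k : 0 < ε k := by have := hA k; positivity
  have hA1 k : 1 ≤ A k := le_add_of_nonneg_right (by positivity)
  have hεle k : ε k ≤ (1 / 2) ^ k := div_le_self (by positivity) (hA1 k)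
  have hder i n : ∀ᶠ k in Filter.cofinite, ∀ y,
      ‖iteratedFDeriv ℝ n (fun y => ε k * G (p i) k y) y‖ ≤ (1 / 2) ^ k := by
    rw [Nat.cofinite_eq_atTop]
    filter_upwards [Filter.eventually_ge_atTop i, Filter.eventually_ge_atTop n] with k hi hn y
    have : (fun y => ε k * G (p i) k y) = ε k • G (p i) k := rfl
    rw [this, iteratedFDeriv_const_smul_apply
      ((hG (p i) k).contDiffAt.of_le (by exact_mod_cast le_top)), norm_smul,
      Real.norm_of_nonneg (hε k).le]
    calc _ ≤ ε k * A k := by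
          gcongr
          exact (hC _ _ _ y).trans (hCA i k n hi hn)
      _ = _ := div_mul_cancel₀ _ (hA k).ne'
  have hsum i : ContDiff ℝ ∞ fun y => ∑' k, ε k * G (p i) k y :=
    contDiff_tsum_of_eventually (N := ⊤) (v := fun _ k => (1 / 2) ^ k)
      (fun k => contDiff_const.mul (hG (p i) k)) (fun _ _ => summable_geometric_two)
      fun n _ => hder i n
  have hsummable i y : Summable fun k => ε k * G (p i) k y := by
    refine .of_norm_bounded_eventually summable_geometric_two ?_
    filter_upwards [hder i 0] with k hk
    simpa only [norm_iteratedFDeriv_zero] using hk y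
  have hGg (x y : M) (hy : y ∈ extChartAt (𝓡 m) x ⁻¹' (Metric.ball (extChartAt (𝓡 m) x x)
      (χ x).rIn) ∩ (extChartAt (𝓡 m) x).source) (k : ℕ) :
      G x k (extChartAt (𝓡 m) x y) = g k y := by
    simp only [G]
    rw [(extChartAt (𝓡 m) x).left_inv hy.2,
      (χ x).one_of_mem_closedBall (Metric.ball_subset_closedBall hy.1), one_mul]
  have hmem (x : M) : ∃ i, x ∈ extChartAt (𝓡 m) (p i) ⁻¹' (Metric.ball
      (extChartAt (𝓡 m) (p i) (p i)) (χ (p i)).rIn) ∩ (extChartAt (𝓡 m) (p i)).source := by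
    simpa using hcover.ge (mem_univ x)
  refine ⟨ε, hε, .of_nonneg_of_le (fun k => (hε k).le) hεle summable_geometric_two,
    fun x => ?_, fun x => ?_⟩
  · obtain ⟨i, hi⟩ := hmem x
    simpa only [hGg _ _ hi] using hsummable i (extChartAt (𝓡 m) (p i) x)
  · obtain ⟨i, hi⟩ := hmem x
    have hopen : IsOpen (extChartAt (𝓡 m) (p i) ⁻¹' (Metric.ball
        (extChartAt (𝓡 m) (p i) (p i)) (χ (p i)).rIn) ∩ (extChartAt (𝓡 m) (p i)).source) := by
      rw [inter_comm]
      exact (continuousOn_extChartAt (p i)).isOpen_inter_preimage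
        (isOpen_extChartAt_source (p i)) Metric.isOpen_ball
    have hchart : ContMDiffAt (𝓡 m) 𝓘(ℝ, EuclideanSpace ℝ (Fin m)) ∞
        (extChartAt (𝓡 m) (p i)) x :=
      contMDiffAt_extChartAt' (by simpa using hi.2)
    refine ((hsum i).contMDiff.contMDiffAt.comp x hchart).congr_of_eventuallyEq ?_
    filter_upwards [hopen.mem_nhds hi] with y hy
    simp only [Function.comp_apply, hGg _ _ hy]

end

namespace IsolatedDynamics

section

theorem maxInv_flow {M : Type*} [TopologicalSpace M] (φ : Flow ℝ M) (N : Set M) {x : M}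
    (hx : x ∈ maxInv φ N) (t : ℝ) : φ t x ∈ maxInv φ N :=
  ⟨hx.2 t, fun s => by rw [← φ.map_add]; exact hx.2 _⟩

variable {m : ℕ} {M : Type*} [TopologicalSpace M] [ChartedSpace (EuclideanSpace ℝ (Fin m)) M]
    [IsManifold (𝓡 m) ∞ M]

/-- A point of `B` whose orbit leaves `B` has a smooth function that vanishes on the maximal
invariant set, does not increase along the flow in `B`, and decreases strictly near the point. -/
theorem exists_bump_decreasing_along_flow [T2Space M] {φ : Flow ℝ M}
    (hφ : ContMDiff (𝓘(ℝ, ℝ).prod (𝓡 m)) (𝓡 m) ∞ (fun q : ℝ × M => φ q.1 q.2))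
    {B : Set M} (hB : IsClosed B) {x : M} (hx : x ∈ B \ maxInv φ B) :
    ∃ (g h : M → ℝ) (T : ℝ), ContMDiff (𝓡 m) 𝓘(ℝ, ℝ) ∞ g ∧ Continuous h ∧ 0 < h x ∧
      (∀ y, h y ∈ Icc 0 1) ∧ (∀ y ∈ maxInv φ B, g y = 0) ∧ (∀ y ∈ B, h (φ T y) = 0) ∧
      ∀ y t, HasDerivAt (fun t => g (φ t y)) (h (φ T (φ t y)) - h (φ t y)) t := by
  -- `T` may have either sign; the oriented integral covers both cases.
  obtain ⟨T, hT⟩ : ∃ T, φ (-T) x ∉ B := by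
    by_contra! H
    exact hx.2 ⟨hx.1, fun t => by simpa using H (-t)⟩
  have hV : φ (-T) ⁻¹' Bᶜ ∈ nhds x :=
    (hB.isOpen_compl.preimage (φ.continuous_toFun (-T))).mem_nhds hT
  obtain ⟨h, -, hsupp⟩ := (SmoothBumpFunction.nhds_basis_tsupport (I := 𝓡 m) x).mem_iff.1 hV
  have hzero (y : M) (hy : φ (-T) y ∈ B) : h y = 0 := by
    by_contra hne
    exact hsupp (subset_tsupport _ hne) hy
  refine ⟨fun y => ∫ s in (0)..T, h (φ s y), h, T,
    contMDiff_flow_intervalIntegral hφ h.contMDiff 0 T, h.continuous, ?_,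
    fun y => h.mem_Icc, fun y hy => ?_, fun y hy => hzero _ ?_,
    fun y t => hasDerivAt_flow_intervalIntegral φ h.continuous T y t⟩
  · simp
  · have (s : ℝ) : h (φ s y) = 0 := hzero _ (maxInv_flow φ B (maxInv_flow φ B hy s) (-T)).1
    simp [this]
  · rw [← φ.map_add]
    simpa using hy

end

end IsolatedDynamics

theorem mainTheorem10 {m : ℕ} {M : Type*} [TopologicalSpace M] [T2Space M]
    [SecondCountableTopology M] [ChartedSpace (EuclideanSpace ℝ (Fin m)) M]
    [IsManifold (𝓡 m) ∞ M]
    (φ : Flow ℝ M)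
    (hφ : ContMDiff (𝓘(ℝ, ℝ).prod (𝓡 m)) (𝓡 m) ∞ (fun q : ℝ × M => φ q.1 q.2))
    (S B : Set M)
    (hS : IsolatedDynamics.IsIsolatedInvariantSet φ S)
    (hB : IsolatedDynamics.IsSmoothIsolatingBlock (m := m) φ B)
    (hBS : IsolatedDynamics.maxInv φ B = S) :
    ∃ f : M → ℝ, IsolatedDynamics.IsSmoothLyapunovFunction (m := m) φ S f ∧
      IsolatedDynamics.HasLyapunovProperty φ S B f := by
  have hclosed : IsClosed B := hB.1.1.isClosed
  suffices H : ∃ f : M → ℝ, ContMDiff (𝓡 m) 𝓘(ℝ, ℝ) ∞ f ∧ (∀ x ∈ S, f x = 0) ∧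
      IsolatedDynamics.HasLyapunovProperty φ S B f by
    obtain ⟨f, hf, hfS, hfB⟩ := H
    exact ⟨f, ⟨hf, ⟨0, hfS⟩, B, hB.1, hBS, hfB⟩, hfB⟩
  rcases (B \ S).eq_empty_or_nonempty with hempty | hne
  · exact ⟨fun _ => 0, contMDiff_const, fun _ _ => rfl, fun x hx => by simp [hempty] at hx⟩
  subst hBS
  choose! g h T hg hh hpos hIcc hgS hhB hder using fun x hx =>
    IsolatedDynamics.exists_bump_decreasing_along_flow hφ hclosed (x := x) hx
  obtain ⟨c, hcB, hc, hcover⟩ := TopologicalSpace.countable_cover_nhdsWithin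
    (f := fun x => {y | 0 < h x y}) fun x hx =>
      mem_nhdsWithin_of_mem_nhds ((isOpen_lt continuous_const (hh x hx)).mem_nhds (hpos x hx))
  obtain ⟨p, rfl⟩ := hc.exists_eq_range (by
    obtain ⟨x, hx⟩ := hne
    obtain ⟨y, hy, -⟩ := mem_iUnion₂.1 (hcover hx)
    exact ⟨y, hy⟩)
  have hp k : p k ∈ B \ IsolatedDynamics.maxInv φ B := hcB (mem_range_self k)
  obtain ⟨ε, hε, hεs, hsum, hsmooth⟩ := exists_contMDiff_tsum fun k => hg (p k) (hp k)
  refine ⟨_, hsmooth, fun x hx => ?_, fun x hx => ?_⟩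
  · simp [hgS _ (hp _) x hx]
  -- Termwise differentiation is allowed because each derivative is `ε k` times a difference of two
  -- values in `[0, 1]`.
  have hd := hasDerivAt_tsum (g := fun k t => ε k * g (p k) (φ t x)) hεs
    (fun k t => (hder (p k) (hp k) x t).const_mul (ε k)) (fun k t => by
      have h1 := hIcc (p k) (hp k) (φ (T (p k)) (φ t x))
      have h2 := hIcc (p k) (hp k) (φ t x)
      rw [norm_mul, Real.norm_of_nonneg (hε k).le, Real.norm_eq_abs]
      exact mul_le_of_le_one_right (hε k).le
        (abs_le.2 ⟨by linarith [h1.1, h2.2], by linarith [h1.2, h2.1]⟩))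
    (hsum (φ 0 x)) 0
  rw [hd.deriv]
  simp only [φ.map_zero_apply, hhB _ (hp _) x hx.1, zero_sub, mul_neg, tsum_neg, neg_lt_zero]
  obtain ⟨y, ⟨k, rfl⟩, hk⟩ := mem_iUnion₂.1 (hcover hx)
  refine Summable.tsum_pos (.of_nonneg_of_le (fun k => ?_) (fun k => ?_) hεs) (fun k => ?_) k
    (mul_pos (hε k) hk)
  · exact mul_nonneg (hε k).le (hIcc _ (hp k) x).1
  · exact mul_le_of_le_one_right (hε k).le (hIcc _ (hp k) x).2
  · exact mul_nonneg (hε k).le (hIcc _ (hp k) x).1
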